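/- Let $\mathcal X$ be a measurable space (for instance $\mathcal X\subseteq\mathbb R^d$), $\mathcal Y=\{-1,+1\}$, $\mathcal G=\{a,b\}$, and let $\mathcal D$ be a probability distribution on $\mathcal X\times\mathcal G\times\mathcal Y$. Let $\mathcal H$ be a measurable space of classifiers $h:\mathcal X\to\mathcal Y'$ and $\ell:\mathcal Y'\times\mathcal Y\to\{0,1\}$ a loss such that $(h,x,y)\mapsto\ell(h(x),y)$ is measurable. For a probability distribution $\rho$ on $\mathcal H$ put $\mathrm R_{\mathcal D}(G_\rho)=\mathbb E_{h\sim\rho}\,\mathbb E_{(x,g,y)\sim\mathcal D}\,\ell(h(x),y)$ and, for $g\in\mathcal G$, $\mathrm R_{\mathcal D_{|g}}(G_\rho)=\mathbb E_{h\sim\rho}\,\mathbb E_{(x,y)\sim\mathcal D_{|g}}\,\ell(h(x),y)$, where $\mathcal D_{|g}$ is the conditional distribution of $(x,y)$ given the group $g$ (if $g$ has probability $0$, put $\mathrm R_{\mathcal D_{|g}}(G_\rho)=0$). Let $\mathrm{RF}_{\mathcal D}(G_\rho)=|\mathrm R_{\mathcal D_{|a}}(G_\rho)-\mathrm R_{\mathcal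 D_{|b}}(G_\rho)|$. For a sample $S=\{(x_i,g_i,y_i)\}_{i=1}^m$, let $S_{|g}$ be the subsample of the examples with $g_i=g$. For $T\in\{S,S_{|a},S_{|b}\}$ of size $n$, let $\widehat{\mathrm R}_T(G_\rho)=\mathbb E_{h\sim\rho}\frac1n\sum_{(x_i,g_i,y_i)\in T}\ell(h(x_i),y_i)$. For a probability distribution $\pi$ on $\mathcal H$ and $\delta'\in(0,1]$ let $$\mathrm R_T^{\uparrow}(\rho,\pi,\delta',G_\rho)=\max\Big\{r\in[0,1]:\mathrm{kl}\big(\widehat{\mathrm R}_T(G_\rho)\,\big\|\,r\big)\le\tfrac1n\big[\mathrm{KL}(\rho\|\pi)+\ln\tfrac{2\sqrt n}{\delta'}\big]\Big\},$$ and let $\mathrm R_T^{\downarrow}(\rho,\pi,\delta',G_\rho)$ be the minimum of the same set. Here $\mathrm{kl}(q\|p)=q\ln\frac qp+(1-q)\ln\frac{1-q}{1-p}\in[0,\infty]$ is the Kullback–Leibler divergence between Bernoulli distributions (with $0\ln 0=0$, and $\mathrm{kl}(q\|p)=\infty$ if $p=0\ne q$ or $p=1\neq q$), and $\mathrm{KL}(\rho\|\pi)\in[0,\infty]$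 is the Kullback–Leibler divergence. If $n=0$, the right-hand side of the constraint is read as $+\infty$, so that $\mathrm R_T^{\uparrow}=1$ and $\mathrm R_T^{\downarrow}=0$. **Theorem.** For every such $\mathcal D$, $\mathcal H$ and $\ell$, every probability distribution $\pi$ on $\mathcal H$ (the prior), every $\delta\in(0,1]$, every $\lambda\in[0,1]$ and every $m$, with probability at least $1-\delta$ over the random choice of $S\sim\mathcal D^m$, for all probability distributions $\rho$ on $\mathcal H$, $$(1-\lambda)\,\mathrm R_{\mathcal D}(G_\rho)+\lambda\,\mathrm{RF}_{\mathcal D}(G_\rho)\le\mathbf G_S(\rho),$$ where $\mathbf G_S$ is the training objective of the stochastic classifier, $$\mathbf G_S(\rho)=(1-\lambda)\,\mathrm R_S^{\uparrow}(\rho,\pi,\tfrac\delta2,G_\rho)+\lambda\max\Big\{\mathrm R_{S_{|a}}^{\uparrow}(\rho,\pi,\tfrac\delta8,G_\rho)-\mathrm R_{S_{|b}}^{\downarrow}(\rho,\pi,\tfrac\delta8,G_\rho),\ \mathrm R_{S_{|b}}^{\uparrow}(\rho,\pi,\tfrac\delta8,G_\rho)-\mathrm R_{S_{|a}}^{\downarrow}(\rho,\pi,\tfrac\delta8,G_\rho)\Big\}.$$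 -/

import Mathlib

open MeasureTheory ProbabilityTheory

noncomputable section

namespace PACBayesFair

/-- The label space `{-1, +1}`. -/
abbrev Label : Type := ({-1, 1} : Set ℤ)

/-- The two values `a`, `b` of the binary sensitive attribute. -/
inductive SensGroup : Type where
  | a : SensGroup
  | b : SensGroup
  deriving DecidableEq

instance : MeasurableSpace SensGroup := ⊤

/-- An example is a triplet (input, sensitive attribute, label). -/
abbrev Example (X : Type*) : Type _ := X × SensGroup × Label

/-- A sample of `m` examples. -/
abbrev Sample (X : Type*) (m : ℕ) : Type _ := Fin m → Example X

/-- `kl(q‖p) = q ln (q/p) + (1-q) ln ((1-q)/(1-p))` for `q, p ∈ [0,1]`, the KL divergence between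
Bernoulli distributions, with values in `[0,∞]`: it is `∞` when `p = 0 ≠ q` or `p = 1 ≠ q`, and
`0 ln 0 = 0`. The real expression below is nonnegative for `q, p ∈ [0,1]`, so that
`ENNReal.ofReal` does not truncate anything. -/
def binKL (q p : ℝ) : ENNReal :=
  if (p = 0 ∧ q ≠ 0) ∨ (p = 1 ∧ q ≠ 1) then ⊤
  else ENNReal.ofReal (q * Real.log (q / p) + (1 - q) * Real.log ((1 - q) / (1 - p)))

/-- The largest `r ∈ [0,1]` with `kl(q‖r) ≤ ε`. -/
def klUpper (q : ℝ) (ε : ENNReal) : ℝ := sSup {r : ℝ | r ∈ Set.Icc 0 1 ∧ binKL q r ≤ ε}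

/-- The smallest `r ∈ [0,1]` with `kl(q‖r) ≤ ε`. -/
def klLower (q : ℝ) (ε : ENNReal) : ℝ := sInf {r : ℝ | r ∈ Set.Icc 0 1 ∧ binKL q r ≤ ε}

section Risks

variable {X Y' H : Type*} [MeasurableSpace X] [MeasurableSpace H]

/-- The true risk of `h` on a distribution `P` over inputs and labels; `pred h : X → Y'` is the
classifier `h`. -/
def trueRisk (ℓ : Y' → Label → ℝ) (pred : H → X → Y') (P : Measure (X × Label)) (h : H) : ℝ :=
  ∫ z, ℓ (pred h z.1) z.2 ∂P

/-- The true Gibbs risk: the `ρ`-average of the true risks. -/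
def gibbsRisk (ℓ : Y' → Label → ℝ) (pred : H → X → Y') (P : Measure (X × Label))
    (ρ : Measure H) : ℝ :=
  ∫ h, trueRisk ℓ pred P h ∂ρ

/-- The distribution of (input, label) under `D`. -/
def inputLabel (D : Measure (Example X)) : Measure (X × Label) :=
  D.map (fun z => (z.1, z.2.2))

/-- The conditional distribution of (input, label) given that the sensitive attribute is `g`
(the zero measure when `g` has probability zero). -/
def groupDist (D : Measure (Example X)) (g : SensGroup) : Measure (X × Label) :=
  inputLabel (ProbabilityTheory.cond D {z | z.2.1 = g})

/-- The true fairness risk of the Gibbs classifier. -/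
def fairRisk (ℓ : Y' → Label → ℝ) (pred : H → X → Y') (D : Measure (Example X))
    (ρ : Measure H) : ℝ :=
  |gibbsRisk ℓ pred (groupDist D SensGroup.a) ρ - gibbsRisk ℓ pred (groupDist D SensGroup.b) ρ|

/-- The indices of the examples of `S` that belong to group `g`. -/
def groupIdx {m : ℕ} (S : Sample X m) (g : SensGroup) : Finset (Fin m) :=
  Finset.univ.filter (fun i => (S i).2.1 = g)

/-- The empirical risk of `h` on the part of `S` with indices in `I`. -/
def empRisk (ℓ : Y' → Label → ℝ) (pred : H → X → Y') {m : ℕ} (S : Sample X m)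
    (I : Finset (Fin m)) (h : H) : ℝ :=
  (∑ i ∈ I, ℓ (pred h (S i).1) (S i).2.2) / (I.card : ℝ)

/-- The empirical Gibbs risk on the part of `S` with indices in `I`. -/
def empGibbsRisk (ℓ : Y' → Label → ℝ) (pred : H → X → Y') {m : ℕ} (S : Sample X m)
    (I : Finset (Fin m)) (ρ : Measure H) : ℝ :=
  ∫ h, empRisk ℓ pred S I h ∂ρ

/-- The complexity term `(KL(ρ‖π) + ln (2√n/δ)) / n` for a sample of size `n`; it is `∞` for an
empty sample. For `n ≥ 1` and `δ ∈ (0,1]` the logarithm is positive. -/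
def complexity (ρ π : Measure H) (δ : ℝ) (n : ℕ) : ENNReal :=
  if n = 0 then ⊤
  else (InformationTheory.klDiv ρ π + ENNReal.ofReal (Real.log (2 * Real.sqrt n / δ))) / n

/-- The upper bound on the Gibbs risk computed from the part of `S` with indices in `I`. -/
def riskUpper (ℓ : Y' → Label → ℝ) (pred : H → X → Y') {m : ℕ} (S : Sample X m)
    (I : Finset (Fin m)) (ρ π : Measure H) (δ : ℝ) : ℝ :=
  klUpper (empGibbsRisk ℓ pred S I ρ) (complexity ρ π δ I.card)

/-- The lower bound on the Gibbs risk computed from the part of `S` with indices in `I`. -/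
def riskLower (ℓ : Y' → Label → ℝ) (pred : H → X → Y') {m : ℕ} (S : Sample X m)
    (I : Finset (Fin m)) (ρ π : Measure H) (δ : ℝ) : ℝ :=
  klLower (empGibbsRisk ℓ pred S I ρ) (complexity ρ π δ I.card)

/-- The training objective `G_S(ρ)` of the stochastic classifier. -/
def trainingObjective (ℓ : Y' → Label → ℝ) (pred : H → X → Y') {m : ℕ} (S : Sample X m)
    (ρ π : Measure H) (δ lam : ℝ) : ℝ :=
  (1 - lam) * riskUpper ℓ pred S Finset.univ ρ π (δ / 2)
    + lam * max
        (riskUpper ℓ pred S (groupIdx S SensGroup.a) ρ π (δ / 8)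
          - riskLower ℓ pred S (groupIdx S SensGroup.b) ρ π (δ / 8))
        (riskUpper ℓ pred S (groupIdx S SensGroup.b) ρ π (δ / 8)
          - riskLower ℓ pred S (groupIdx S SensGroup.a) ρ π (δ / 8))

end Risks

end PACBayesFair

end

/-! The three risks (overall, group a, group b) are handled by a single PAC-Bayes-kl bound for the
examples falling in a measurable set `A`, used with `A` the whole space and with each group.

For fixed `h`, condition on the set `I` of indices of examples in `A`. The number `k` of errors
among them is then binomial with parameters `n = |I|` and the conditional risk `r`, and the mean of
`exp (n kl(k/n‖r)) / (2√n)` is at most 1 (`sum_powerset_mul_klWeight_le_one`). This holds for every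
`I`, so the random group size costs no union bound (`lintegral_expKl_le_one`). Tonelli and Markov
then give one event, independent of the posterior, on which the prior average of this exponential is
at most `1/δ`.

On that event Donsker–Varadhan controls every `ρ` at once (`binKL_integral_le_complexity`). Jensen's
inequality for kl enters by writing kl as a supremum of affine functions: change of measure is
applied to each of them, where averaging is exact and integrability is automatic, and the supremum
is taken last.

The constant `2√n` comes from Abel's binomial identity, which turns the binomial moment into the sum
of the tail probabilities of a birthday-collision time. Since kl bounds both sides, one event per
set `A` yields both the upper and the lower risk bound. -/

namespace PACBayesFair

/-! ### Abel's identity and Maurer's moment bound -/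

/-- Cauchy's form of Abel's binomial identity. -/
theorem sum_choose_mul_add_pow_mul_add_pow (n : ℕ) : ∀ x y : ℝ,
    ∑ k ∈ Finset.range (n + 1),
      (n.choose k : ℝ) * (x + k) ^ k * (y + ((n - k : ℕ) : ℝ)) ^ (n - k)
      = ∑ j ∈ Finset.range (n + 1), (n.descFactorial j : ℝ) * (x + y + n) ^ (n - j) := by
  induction n with
  | zero => intro x y; simp
  | succ n ih =>
    intro x
    set F : ℝ → ℝ := fun y => ∑ k ∈ Finset.range (n + 1 + 1),
      ((n + 1).choose k : ℝ) * (x + k) ^ k * (y + ((n + 1 - k : ℕ) : ℝ)) ^ (n + 1 - k) with hF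
    set G : ℝ → ℝ := fun y => ∑ j ∈ Finset.range (n + 1 + 1),
      ((n + 1).descFactorial j : ℝ) * (x + y + (n + 1 : ℕ)) ^ (n + 1 - j) with hG
    -- Differentiating in `y` lowers the degree to `n` and shifts `y` to `y + 1`, so by induction
    -- both sides have the same derivative; one value of `y` remains to be compared.
    have hF' : ∀ y, HasDerivAt F ((n + 1 : ℝ) * ∑ k ∈ Finset.range (n + 1),
        (n.choose k : ℝ) * (x + k) ^ k * ((y + 1) + ((n - k : ℕ) : ℝ)) ^ (n - k)) y := by
      intro y
      have h : HasDerivAt F (∑ k ∈ Finset.range (n + 1 + 1),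
          ((n + 1).choose k : ℝ) * (x + k) ^ k * (((n + 1 - k : ℕ) : ℝ) *
            (y + ((n + 1 - k : ℕ) : ℝ)) ^ (n + 1 - k - 1) * 1)) y := by
        refine HasDerivAt.fun_sum fun k _ => ?_
        exact (((hasDerivAt_id y).add_const _).pow _).const_mul _
      convert h using 1
      rw [Finset.sum_range_succ _ (n + 1), Finset.mul_sum]
      simp only [Nat.sub_self, Nat.cast_zero, zero_mul, mul_zero, add_zero]
      refine Finset.sum_congr rfl fun k hk => ?_
      have hk : k ≤ n := Nat.lt_succ_iff.mp (Finset.mem_range.mp hk)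
      have hc : (n.choose k : ℝ) * (n + 1) = (n + 1).choose k * ((n + 1 - k : ℕ) : ℝ) := by
        exact_mod_cast Nat.choose_mul_succ_eq n k
      have e1 : n + 1 - k - 1 = n - k := by omega
      have e2 : y + 1 + ((n - k : ℕ) : ℝ) = y + ((n + 1 - k : ℕ) : ℝ) := by
        rw [Nat.succ_sub hk]; push_cast; ring
      rw [e1, e2]
      linear_combination ((x + k) ^ k * (y + ((n + 1 - k : ℕ) : ℝ)) ^ (n - k)) * hc
    have hG' : ∀ y, HasDerivAt G ((n + 1 : ℝ) * ∑ j ∈ Finset.range (n + 1),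
        (n.descFactorial j : ℝ) * (x + (y + 1) + n) ^ (n - j)) y := by
      intro y
      have h : HasDerivAt G (∑ j ∈ Finset.range (n + 1 + 1),
          ((n + 1).descFactorial j : ℝ) * (((n + 1 - j : ℕ) : ℝ) *
            (x + y + (n + 1 : ℕ)) ^ (n + 1 - j - 1) * 1)) y := by
        refine HasDerivAt.fun_sum fun k _ => ?_
        exact ((((hasDerivAt_id y).const_add x).add_const _).pow _).const_mul _
      convert h using 1
      rw [Finset.sum_range_succ _ (n + 1), Finset.mul_sum]
      simp only [Nat.sub_self, Nat.cast_zero, zero_mul, mul_zero, add_zero]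
      refine Finset.sum_congr rfl fun j _ => ?_
      have hc : ((n + 1 : ℕ) : ℝ) * n.descFactorial j
          = ((n + 1 - j : ℕ) : ℝ) * (n + 1).descFactorial j := by
        exact_mod_cast (Nat.succ_descFactorial_succ n j).symm.trans
          (Nat.descFactorial_succ (n + 1) j)
      have e1 : n + 1 - j - 1 = n - j := by omega
      have e2 : x + (y + 1) + (n : ℝ) = x + y + (n + 1 : ℕ) := by push_cast; ring
      rw [e1, e2]
      push_cast at hc ⊢
      linear_combination (x + y + (n + 1)) ^ (n - j) * hc
    have hdiff : ∀ y, HasDerivAt (fun y => F y - G y) 0 y := by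
      intro y
      have := (hF' y).sub (hG' y)
      rwa [ih x (y + 1), sub_self] at this
    -- Here the two powers merge into `± (x + k) ^ (n + 1)`, and the sum is the `(n + 1)`-st finite
    -- difference of a monic power of that degree.
    have hF0 : F (-x - (n + 1 : ℕ)) = (n + 1).factorial := by
      have h1 := congrFun (fwdDiff_iter_eq_factorial (R := ℝ) (n := n + 1)) x
      rw [fwdDiff_iter_eq_sum_shift] at h1
      rw [Pi.natCast_apply] at h1
      rw [← h1, hF]
      refine Finset.sum_congr rfl fun k hk => ?_
      have hk : k ≤ n + 1 := Nat.lt_succ_iff.mp (Finset.mem_range.mp hk)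
      have e : -x - ((n + 1 : ℕ) : ℝ) + ((n + 1 - k : ℕ) : ℝ) = (-1) * (x + k) := by
        rw [Nat.cast_sub hk]; ring
      rw [e, mul_pow]
      have e3 : (x + k) ^ (n + 1) = (x + k) ^ k * (x + (k : ℝ)) ^ (n + 1 - k) := by
        rw [← pow_add]; congr 1; omega
      simp only [nsmul_eq_mul, mul_one, zsmul_eq_mul, e3]
      push_cast
      ring
    have hG0 : G (-x - (n + 1 : ℕ)) = (n + 1).factorial := by
      have e : x + (-x - ((n + 1 : ℕ) : ℝ)) + (n + 1 : ℕ) = 0 := by ring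
      simp only [hG, e]
      rw [Finset.sum_eq_single (n + 1)]
      · rw [Nat.descFactorial_self]; simp
      · intro j hj hne
        have : n + 1 - j ≠ 0 := by
          have := Finset.mem_range.mp hj
          omega
        simp [this]
      · simp
    intro y
    have hconst := is_const_of_deriv_eq_zero (fun z => (hdiff z).differentiableAt)
      (fun z => (hdiff z).deriv) y (-x - (n + 1 : ℕ))
    simp only [hF0, hG0, sub_self] at hconst
    exact sub_eq_zero.mp hconst

/-- A bound for the total mass of the tail function of the first collision time, obtained from the
nonnegativity of the variance of that time. -/
theorem sum_range_le_two_mul_sqrt {n : ℕ} (hn : 0 < n) (q : ℕ → ℝ) (h0 : q 0 = 1)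
    (hq : ∀ j ≤ n, 0 ≤ q j) (hstep : ∀ j, q (j + 1) = q j * (1 - j / n)) :
    ∑ j ∈ Finset.range (n + 1), q j ≤ 2 * √n := by
  have hn' : (0 : ℝ) < n := by exact_mod_cast hn
  have hlast : q (n + 1) = 0 := by rw [hstep, div_self hn'.ne']; ring
  -- The recursion reads `j * q j = n * (q j - q (j + 1))`, so the sum telescopes.
  have h1 : ∀ N, ∑ j ∈ Finset.range N, (j : ℝ) * q j = n * (1 - q N) := by
    intro N
    induction N with
    | zero => simp [h0]
    | succ N ih => rw [Finset.sum_range_succ, ih, hstep]; field_simp; ring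
  have h2 : ∀ N, ∑ j ∈ Finset.range N, (q j - q (j + 1)) = 1 - q N := by
    intro N
    induction N with
    | zero => simp [h0]
    | succ N ih => rw [Finset.sum_range_succ, ih]; ring
  have h3 : ∀ N, ∑ j ∈ Finset.range N, (j : ℝ) * (q j - q (j + 1))
      = ∑ j ∈ Finset.range N, q j - 1 - (N - 1) * q N := by
    intro N
    induction N with
    | zero => simp [h0]
    | succ N ih => rw [Finset.sum_range_succ, ih, Finset.sum_range_succ]; push_cast; ring
  have h4 : ∀ N, ∑ j ∈ Finset.range N, (j : ℝ) ^ 2 * (q j - q (j + 1))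
      = 2 * ∑ j ∈ Finset.range N, (j : ℝ) * q j - ∑ j ∈ Finset.range N, q j + 1
        - (N - 1) ^ 2 * q N := by
    intro N
    induction N with
    | zero => simp [h0]
    | succ N ih =>
      rw [Finset.sum_range_succ, ih, Finset.sum_range_succ, Finset.sum_range_succ _ N]
      push_cast; ring
  set s := ∑ j ∈ Finset.range (n + 1), q j with hs
  -- The collision time takes the value `j` with probability `q j - q (j + 1)`, and its mean is `s -
  -- 1`.
  have hvar : 0 ≤ ∑ j ∈ Finset.range (n + 1), ((j : ℝ) - (s - 1)) ^ 2 * (q j - q (j + 1)) := by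
    refine Finset.sum_nonneg fun j hj => mul_nonneg (sq_nonneg _) ?_
    have hj : j ≤ n := Nat.lt_succ_iff.mp (Finset.mem_range.mp hj)
    have : q j - q (j + 1) = q j * (j / n) := by rw [hstep]; ring
    rw [this]
    exact mul_nonneg (hq j hj) (by positivity)
  have hexp : ∑ j ∈ Finset.range (n + 1), ((j : ℝ) - (s - 1)) ^ 2 * (q j - q (j + 1))
      = ∑ j ∈ Finset.range (n + 1), (j : ℝ) ^ 2 * (q j - q (j + 1))
        - 2 * (s - 1) * ∑ j ∈ Finset.range (n + 1), (j : ℝ) * (q j - q (j + 1))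
        + (s - 1) ^ 2 * ∑ j ∈ Finset.range (n + 1), (q j - q (j + 1)) := by
    rw [Finset.mul_sum, Finset.mul_sum, ← Finset.sum_sub_distrib, ← Finset.sum_add_distrib]
    exact Finset.sum_congr rfl fun j _ => by ring
  rw [hexp, h4, h3, h2, h1, hlast, ← hs] at hvar
  have hsq : √(n : ℝ) ^ 2 = n := Real.sq_sqrt hn'.le
  have hone : (1 : ℝ) ≤ √n := Real.one_le_sqrt.mpr (by exact_mod_cast hn)
  -- The variance inequality now reads `s * (s - 1) ≤ 2 * n`, whereas `s > 2√n` and `√n ≥ 1` would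
  -- give `s * (s - 1) > 4 * n - 2√n ≥ 2 * n`.
  by_contra! hlt
  nlinarith

/-- Maurer's bound in the form valid for all `n ≥ 1`. -/
theorem sum_choose_mul_pow_mul_pow_le {n : ℕ} (hn : 0 < n) :
    ∑ k ∈ Finset.range (n + 1),
      (n.choose k : ℝ) * ((k / n : ℝ) ^ k * (1 - k / n : ℝ) ^ (n - k)) ≤ 2 * √n := by
  have hn' : (0 : ℝ) < n := by exact_mod_cast hn
  have habel := sum_choose_mul_add_pow_mul_add_pow n 0 0
  have hL : ∑ k ∈ Finset.range (n + 1),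
      (n.choose k : ℝ) * ((k / n : ℝ) ^ k * (1 - k / n : ℝ) ^ (n - k))
      = ∑ j ∈ Finset.range (n + 1), (n.descFactorial j : ℝ) / (n : ℝ) ^ j := by
    have hR : ∑ j ∈ Finset.range (n + 1), (n.descFactorial j : ℝ) / (n : ℝ) ^ j
        = (∑ j ∈ Finset.range (n + 1), (n.descFactorial j : ℝ) * (0 + 0 + n) ^ (n - j))
          / (n : ℝ) ^ n := by
      rw [Finset.sum_div]
      refine Finset.sum_congr rfl fun j hj => ?_
      have hj : j ≤ n := Nat.lt_succ_iff.mp (Finset.mem_range.mp hj)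
      have e : (n : ℝ) ^ n = (n : ℝ) ^ j * (n : ℝ) ^ (n - j) := by
        rw [← pow_add]; congr 1; omega
      rw [e, zero_add, zero_add]
      field_simp
    rw [hR, ← habel, Finset.sum_div]
    refine Finset.sum_congr rfl fun k hk => ?_
    have hk : k ≤ n := Nat.lt_succ_iff.mp (Finset.mem_range.mp hk)
    have e : (n : ℝ) ^ n = (n : ℝ) ^ k * (n : ℝ) ^ (n - k) := by
      rw [← pow_add]; congr 1; omega
    have e2 : (1 - k / n : ℝ) = ((n - k : ℕ) : ℝ) / n := by
      rw [Nat.cast_sub hk]; field_simp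
    rw [e2, e, zero_add, zero_add, div_pow, div_pow]
    field_simp
  -- Abel's identity at `x = y = 0`, divided by `n ^ n`, leaves the probabilities that `j` uniform
  -- draws from `n` values are distinct.
  rw [hL]
  refine sum_range_le_two_mul_sqrt hn _ (by simp) (fun j _ => by positivity) fun j => ?_
  rcases le_or_gt j n with hj | hj
  · rw [Nat.descFactorial_succ, Nat.cast_mul, Nat.cast_sub hj]
    field_simp
    ring
  · rw [Nat.descFactorial_of_lt hj, Nat.descFactorial_of_lt (Nat.lt_succ_of_lt hj)]
    simp

/-! ### Binary kl as a supremum of affine functions -/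

/-- A family of affine functions of `(q, p)`, whose supremum over `α, β > 0` is `kl(q‖p)`. -/
noncomputable def klAffine (α β q p : ℝ) : ℝ :=
  q * Real.log α + (1 - q) * Real.log β + 1 - (p * α + (1 - p) * β)

theorem exists_mul_log_div_sub_le {q p : ℝ} (hq : 0 ≤ q) (hp : 0 ≤ p) (h : p = 0 → q = 0)
    {ε : ℝ} (hε : 0 < ε) :
    ∃ α > 0, q * Real.log (q / p) - ε ≤ q * Real.log α + q - p * α := by
  rcases hq.eq_or_lt with rfl | hq
  · refine ⟨ε / (p + 1), by positivity, ?_⟩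
    have : p * (ε / (p + 1)) ≤ ε := by
      rw [← mul_div_assoc, div_le_iff₀ (by positivity)]
      nlinarith
    simp only [zero_mul]
    linarith
  · have hp : 0 < p := lt_of_le_of_ne hp fun h0 => hq.ne' (h h0.symm)
    refine ⟨q / p, by positivity, ?_⟩
    rw [mul_div_cancel₀ q hp.ne']
    linarith

theorem binKL_le_ofReal {q p C : ℝ} (hq : q ∈ Set.Icc (0 : ℝ) 1) (hp : p ∈ Set.Icc (0 : ℝ) 1)
    (h : ∀ α > 0, ∀ β > 0, klAffine α β q p ≤ C) : binKL q p ≤ ENNReal.ofReal C := by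
  obtain ⟨hq0, hq1⟩ := hq
  obtain ⟨hp0, hp1⟩ := hp
  have hleft : p = 0 → q = 0 := by
    intro h0
    by_contra hne
    -- With `p = 0` this choice makes the affine function equal to `C + 1`.
    have := h (Real.exp ((C + 1) / q)) (Real.exp_pos _) 1 one_pos
    simp only [klAffine, Real.log_exp, Real.log_one, mul_div_cancel₀ _ hne, h0] at this
    linarith
  have hright : 1 - p = 0 → 1 - q = 0 := by
    intro h0
    by_contra hne
    have h1 : p = 1 := by linarith
    have := h 1 one_pos (Real.exp ((C + 1) / (1 - q))) (Real.exp_pos _)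
    simp only [klAffine, Real.log_exp, Real.log_one, mul_div_cancel₀ _ hne, h1] at this
    linarith
  have hcond : ¬ ((p = 0 ∧ q ≠ 0) ∨ (p = 1 ∧ q ≠ 1)) := by
    rintro (⟨h0, h1⟩ | ⟨h0, h1⟩)
    · exact h1 (hleft h0)
    · exact h1 (by linarith [hright (by linarith)])
  rw [binKL, if_neg hcond]
  refine ENNReal.ofReal_le_ofReal (le_of_forall_pos_le_add fun ε hε => ?_)
  obtain ⟨α, hα, hα'⟩ := exists_mul_log_div_sub_le hq0 hp0 hleft (half_pos hε)
  obtain ⟨β, hβ, hβ'⟩ := exists_mul_log_div_sub_le (sub_nonneg.mpr hq1) (sub_nonneg.mpr hp1)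
    hright (half_pos hε)
  have := h α hα β hβ
  rw [klAffine] at this
  linarith

/-- The success half of "each affine function is at most kl", exponentiated to avoid logarithms of
zero. It reduces to `x ≤ exp (x - 1)` at `x = r * α * n / k`. -/
theorem exp_mul_pow_le {n k : ℕ} (hn : 0 < n) {α r : ℝ} (hα : 0 < α) (hr : 0 ≤ r) :
    Real.exp (n * ((k / n : ℝ) * Real.log α + k / n - r * α)) * r ^ k ≤ (k / n : ℝ) ^ k := by
  have hn' : (0 : ℝ) < n := by exact_mod_cast hn
  rcases Nat.eq_zero_or_pos k with rfl | hk
  · have : 0 ≤ n * (r * α) := by positivity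
    simpa using this
  · have hk' : (0 : ℝ) < k := by exact_mod_cast hk
    have e1 : (n : ℝ) * ((k / n : ℝ) * Real.log α + k / n - r * α)
        = k * Real.log α + k * (1 - r * α * n / k) := by
      field_simp; ring
    have hx : r * α * n / k ≤ Real.exp (r * α * n / k - 1) := by
      linarith [Real.add_one_le_exp (r * α * n / k - 1)]
    rw [e1, Real.exp_add, Real.exp_nat_mul, Real.exp_nat_mul, Real.exp_log hα, ← mul_pow,
      ← mul_pow]
    refine pow_le_pow_left₀ (by positivity) ?_ _
    have hE := Real.exp_pos (1 - r * α * n / k)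
    have hprod : Real.exp (1 - r * α * n / k) * Real.exp (r * α * n / k - 1) = 1 := by
      rw [← Real.exp_add, ← Real.exp_zero]; congr 1; ring
    have e2 : α * Real.exp (1 - r * α * n / k) * r
        = (k / n) * (Real.exp (1 - r * α * n / k) * (r * α * n / k)) := by
      field_simp
    rw [e2]
    calc (k / n : ℝ) * (Real.exp (1 - r * α * n / k) * (r * α * n / k))
        ≤ (k / n) * (Real.exp (1 - r * α * n / k) * Real.exp (r * α * n / k - 1)) := by gcongr
      _ = k / n := by rw [hprod, mul_one]

theorem exp_klAffine_mul_le {n k : ℕ} (hn : 0 < n) (hk : k ≤ n) {α β r : ℝ} (hα : 0 < α)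
    (hβ : 0 < β) (hr : r ∈ Set.Icc (0 : ℝ) 1) :
    Real.exp (n * klAffine α β (k / n) r) * (r ^ k * (1 - r) ^ (n - k))
      ≤ (k / n : ℝ) ^ k * (1 - k / n : ℝ) ^ (n - k) := by
  have hn' : (0 : ℝ) < n := by exact_mod_cast hn
  have e : (1 - k / n : ℝ) = ((n - k : ℕ) : ℝ) / n := by
    rw [Nat.cast_sub hk]; field_simp
  have h1 := exp_mul_pow_le (k := k) hn hα hr.1
  have h2 := exp_mul_pow_le (k := n - k) hn hβ (sub_nonneg.mpr hr.2)
  rw [← e] at h2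
  have hsplit : n * klAffine α β (k / n) r = n * ((k / n : ℝ) * Real.log α + k / n - r * α)
      + n * ((1 - k / n : ℝ) * Real.log β + (1 - k / n) - (1 - r) * β) := by
    rw [klAffine]; ring
  rw [hsplit, Real.exp_add]
  calc _ = (Real.exp (n * ((k / n : ℝ) * Real.log α + k / n - r * α)) * r ^ k)
        * (Real.exp (n * ((1 - k / n : ℝ) * Real.log β + (1 - k / n) - (1 - r) * β))
          * (1 - r) ^ (n - k)) := by ring
    _ ≤ _ := mul_le_mul h1 h2
      (mul_nonneg (Real.exp_pos _).le (pow_nonneg (sub_nonneg.mpr hr.2) _)) (by positivity)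

/-! ### Change of measure -/

/-- The Donsker–Varadhan change of measure inequality. -/
theorem integral_le_klDiv_add_log_integral_exp {H : Type*} [MeasurableSpace H] {ρ π : Measure H}
    [IsProbabilityMeasure ρ] [IsProbabilityMeasure π] (hkl : InformationTheory.klDiv ρ π ≠ ⊤)
    {φ : H → ℝ} (hφ : Integrable φ ρ) (hexp : Integrable (fun h => Real.exp (φ h)) π) :
    ∫ h, φ h ∂ρ
      ≤ (InformationTheory.klDiv ρ π).toReal + Real.log (∫ h, Real.exp (φ h) ∂π) := by
  obtain ⟨hac, hint⟩ := InformationTheory.klDiv_ne_top_iff.mp hkl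
  have : IsProbabilityMeasure (π.tilted φ) := isProbabilityMeasure_tilted hexp
  have h := InformationTheory.integral_llr_add_sub_measure_univ_nonneg
    (hac.trans (absolutelyContinuous_tilted hexp))
    (integrable_llr_tilted_right hac hφ hint hexp)
  rw [integral_llr_tilted_right hac hφ hexp hint] at h
  rw [InformationTheory.toReal_klDiv_of_measure_eq hac (by simp)]
  simp only [probReal_univ] at h
  linarith

/-! ### The exponential moment of a binomial variable -/

/-- The exponential `exp (n kl(k/n‖r)) / (2√n)`, written without logarithms. -/
noncomputable def klWeight (n k : ℕ) (r : ℝ) : ENNReal :=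
  ENNReal.ofReal ((k / n : ℝ) ^ k * (1 - k / n : ℝ) ^ (n - k) / (2 * √n))
    / ENNReal.ofReal (r ^ k * (1 - r) ^ (n - k))

theorem measurable_klWeight (n k : ℕ) : Measurable (klWeight n k) := by
  unfold klWeight
  fun_prop

theorem ofReal_exp_klAffine_le_klWeight {n k : ℕ} (hn : 0 < n) (hk : k ≤ n) {α β r : ℝ}
    (hα : 0 < α) (hβ : 0 < β) (hr : r ∈ Set.Icc (0 : ℝ) 1) :
    ENNReal.ofReal (Real.exp (n * klAffine α β (k / n) r) / (2 * √n)) ≤ klWeight n k r := by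
  have hn' : (0 : ℝ) < n := by exact_mod_cast hn
  -- The numerator is positive because `0 ^ 0 = 1`; hence a vanishing denominator makes the weight
  -- infinite, as kl requires.
  have hc : (0 : ℝ) < (k / n : ℝ) ^ k * (1 - k / n : ℝ) ^ (n - k) := by
    refine mul_pos ?_ ?_
    · rcases Nat.eq_zero_or_pos k with rfl | hk0
      · simp
      · have : (0 : ℝ) < k := by exact_mod_cast hk0
        positivity
    · rcases hk.eq_or_lt with rfl | hlt
      · simp
      · have : (k : ℝ) / n < 1 := by
          rw [div_lt_one hn']; exact_mod_cast hlt
        exact pow_pos (by linarith) _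
  have hs : 0 < 2 * √(n : ℝ) := by positivity
  rw [klWeight, ENNReal.le_div_iff_mul_le (Or.inr ?_) (Or.inr ENNReal.ofReal_ne_top),
    ← ENNReal.ofReal_mul (by positivity)]
  · refine ENNReal.ofReal_le_ofReal ?_
    rw [div_mul_eq_mul_div]
    exact div_le_div_of_nonneg_right (exp_klAffine_mul_le hn hk hα hβ hr) hs.le
  · exact (ENNReal.ofReal_pos.mpr (by positivity)).ne'

/-- The binomial probabilities cancel the denominators of the weights, and what remains is Maurer's
sum, which no longer depends on `r`. -/
theorem sum_powerset_mul_klWeight_le_one {ι : Type*} (I : Finset ι) {r : ℝ}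
    (hr : r ∈ Set.Icc (0 : ℝ) 1) :
    ∑ J ∈ I.powerset, ENNReal.ofReal r ^ J.card * ENNReal.ofReal (1 - r) ^ (I.card - J.card)
      * klWeight I.card J.card r ≤ 1 := by
  set n := I.card with hn
  have hr' : 0 ≤ 1 - r := sub_nonneg.mpr hr.2
  have hnonneg : ∀ k ∈ Finset.range (n + 1),
      0 ≤ (k / n : ℝ) ^ k * (1 - k / n : ℝ) ^ (n - k) / (2 * √n) := by
    intro k hk
    have hk : (k : ℝ) ≤ n := by exact_mod_cast Nat.lt_succ_iff.mp (Finset.mem_range.mp hk)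
    have : 0 ≤ 1 - (k / n : ℝ) := sub_nonneg.mpr (div_le_one_of_le₀ hk (by positivity))
    positivity
  calc ∑ J ∈ I.powerset, ENNReal.ofReal r ^ J.card * ENNReal.ofReal (1 - r) ^ (n - J.card)
      * klWeight n J.card r
      ≤ ∑ J ∈ I.powerset, ENNReal.ofReal ((J.card / n : ℝ) ^ J.card
          * (1 - J.card / n : ℝ) ^ (n - J.card) / (2 * √n)) := by
        refine Finset.sum_le_sum fun J _ => ?_
        rw [← ENNReal.ofReal_pow hr.1, ← ENNReal.ofReal_pow hr',
          ← ENNReal.ofReal_mul (pow_nonneg hr.1 _), klWeight]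
        -- Only an inequality: the cancelled factor may be zero.
        exact ENNReal.mul_div_le
    _ = ∑ k ∈ Finset.range (n + 1), n.choose k •
          ENNReal.ofReal ((k / n : ℝ) ^ k * (1 - k / n : ℝ) ^ (n - k) / (2 * √n)) :=
        Finset.sum_powerset_apply_card
          (fun k => ENNReal.ofReal ((k / n : ℝ) ^ k * (1 - k / n : ℝ) ^ (n - k) / (2 * √n)))
    _ = ENNReal.ofReal ((∑ k ∈ Finset.range (n + 1),
          (n.choose k : ℝ) * ((k / n : ℝ) ^ k * (1 - k / n : ℝ) ^ (n - k))) / (2 * √n)) := by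
        rw [Finset.sum_div, ENNReal.ofReal_sum_of_nonneg]
        · refine Finset.sum_congr rfl fun k _ => ?_
          rw [mul_div_assoc (n.choose k : ℝ), ENNReal.ofReal_mul (by positivity),
            ENNReal.ofReal_natCast, nsmul_eq_mul]
        · intro k hk
          rw [mul_div_assoc (n.choose k : ℝ)]
          exact mul_nonneg (by positivity) (hnonneg k hk)
    _ ≤ 1 := by
        rcases Nat.eq_zero_or_pos n with h0 | hpos
        -- For `n = 0` the division by `2 * √0` gives 0.
        · simp [h0]
        · rw [ENNReal.ofReal_le_one]
          exact div_le_one_of_le₀ (sum_choose_mul_pow_mul_pow_le hpos) (by positivity)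

theorem prod_ite_mem_ite_mem {m : ℕ} {M : Type*} [CommMonoid M] {I J : Finset (Fin m)}
    (hJ : J ⊆ I) (a b c : M) :
    ∏ i, (if i ∈ J then a else if i ∈ I then b else c)
      = a ^ J.card * b ^ (I.card - J.card) * c ^ (m - I.card) := by
  rw [Finset.prod_ite, Finset.prod_ite, Finset.prod_const, Finset.prod_const, Finset.prod_const,
    Finset.filter_filter, Finset.filter_filter, mul_assoc]
  congr 3
  · simp
  · rw [← Finset.card_sdiff_of_subset hJ]
    congr 1
    ext; simp [and_comm]
  · have hcompl : Iᶜ.card = m - I.card := by rw [Finset.card_compl, Fintype.card_fin]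
    rw [← hcompl]
    congr 1; ext i; simpa using fun h hJi => h (hJ hJi)

/-! ### Samples split by membership in `A` and by errors -/

section Cells

variable {Z H : Type*}

/-- The samples whose examples in `A` are those with index in `I`, and whose examples in `A ∩ B`
are those with index in `J`. -/
def cell (A B : Set Z) {m : ℕ} (I J : Finset (Fin m)) : Set (Fin m → Z) :=
  Set.univ.pi fun i => if i ∈ J then A ∩ B else if i ∈ I then A \ B else Aᶜ

/-- The function `(S, h) ↦ exp (n kl(k/n‖r h)) / (2√n)`, where `n` and `k` are the numbers of
examples of `S` in `A` and in `A ∩ B h`. -/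
noncomputable def expKl (A : Set Z) (B : H → Set Z) (r : H → ℝ) {m : ℕ} (S : Fin m → Z) (h : H) :
    ENNReal :=
  ∑ I : Finset (Fin m), ∑ J ∈ I.powerset,
    (cell A (B h) I J).indicator (fun _ => klWeight I.card J.card (r h)) S

theorem klWeight_le_expKl {A : Set Z} {B : H → Set Z} {r : H → ℝ} {m : ℕ} {S : Fin m → Z} {h : H}
    {I J : Finset (Fin m)} (hI : ∀ i, i ∈ I ↔ S i ∈ A) (hJ : ∀ i, i ∈ J ↔ i ∈ I ∧ S i ∈ B h) :
    klWeight I.card J.card (r h) ≤ expKl A B r S h := by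
  have hS : S ∈ cell A (B h) I J := by
    intro i _
    have h1 := hI i
    have h2 := hJ i
    by_cases hiJ : i ∈ J
    · simp_all
    · by_cases hiI : i ∈ I
      · simp_all
      · simp_all
  have hsub : J ∈ I.powerset := Finset.mem_powerset.mpr fun i hi => ((hJ i).mp hi).1
  calc klWeight I.card J.card (r h)
      = (cell A (B h) I J).indicator (fun _ => klWeight I.card J.card (r h)) S := by
        rw [Set.indicator_of_mem hS]
    _ ≤ ∑ J ∈ I.powerset,
        (cell A (B h) I J).indicator (fun _ => klWeight I.card J.card (r h)) S :=
      Finset.single_le_sum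
        (f := fun J => (cell A (B h) I J).indicator (fun _ => klWeight I.card J.card (r h)) S)
        (fun _ _ => zero_le) hsub
    _ ≤ expKl A B r S h :=
      Finset.single_le_sum (f := fun I => ∑ J ∈ I.powerset,
        (cell A (B h) I J).indicator (fun _ => klWeight I.card J.card (r h)) S)
        (fun _ _ => zero_le) (Finset.mem_univ I)

variable [MeasurableSpace Z]

theorem measurable_expKl [MeasurableSpace H] {A : Set Z} (hA : MeasurableSet A) {B : H → Set Z}
    (hB : MeasurableSet {p : H × Z | p.2 ∈ B p.1}) {r : H → ℝ} (hr : Measurable r) (m : ℕ) :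
    Measurable fun p : (Fin m → Z) × H => expKl A B r p.1 p.2 := by
  refine Finset.measurable_sum _ fun I _ => Finset.measurable_sum _ fun J _ => ?_
  have hset : MeasurableSet {p : (Fin m → Z) × H | p.1 ∈ cell A (B p.2) I J} := by
    have : {p : (Fin m → Z) × H | p.1 ∈ cell A (B p.2) I J}
        = ⋂ i, {p | p.1 i ∈ (if i ∈ J then A ∩ B p.2 else if i ∈ I then A \ B p.2 else Aᶜ)} := by
      ext p; simp [cell]
    rw [this]
    refine MeasurableSet.iInter fun i => ?_
    have hi : Measurable fun p : (Fin m → Z) × H => p.1 i := by fun_prop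
    have hAi : MeasurableSet {p : (Fin m → Z) × H | p.1 i ∈ A} := hi hA
    have hBi : MeasurableSet {p : (Fin m → Z) × H | p.1 i ∈ B p.2} :=
      (measurable_snd.prodMk hi) hB
    split_ifs
    · exact hAi.inter hBi
    · exact hAi.diff hBi
    · exact hAi.compl
  exact ((measurable_klWeight _ _).comp (hr.comp measurable_snd)).indicator hset

/-- Each cell is a product set, whose probability factors into that of the index set `I` and a
binomial weight in `J`. The inner sum over `J` is at most 1, and the probabilities of the sets `I`
add up to 1. -/
theorem lintegral_expKl_le_one (D : Measure Z) [IsProbabilityMeasure D] {A : Set Z}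
    (hA : MeasurableSet A) {B : H → Set Z} {h : H} (hB : MeasurableSet (B h)) {r : H → ℝ}
    (hr : r h ∈ Set.Icc (0 : ℝ) 1) (hD : D (A ∩ B h) = D A * ENNReal.ofReal (r h)) (m : ℕ) :
    ∫⁻ S, expKl A B r S h ∂(Measure.pi fun _ : Fin m => D) ≤ 1 := by
  have hdiff : D (A \ B h) = D A * ENNReal.ofReal (1 - r h) := by
    rw [← Set.sdiff_inter_self_eq_sdiff, Set.inter_comm,
      measure_sdiff Set.inter_subset_left (hA.inter hB).nullMeasurableSet (measure_ne_top _ _), hD,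
      ENNReal.ofReal_sub _ hr.1, ENNReal.ofReal_one, ENNReal.mul_sub, mul_one]
    exact fun _ _ => measure_ne_top _ _
  have hcell : ∀ I J : Finset (Fin m), MeasurableSet (cell A (B h) I J) := by
    intro I J
    refine MeasurableSet.univ_pi fun i => ?_
    split_ifs
    · exact hA.inter hB
    · exact hA.diff hB
    · exact hA.compl
  have hmeas : ∀ I J : Finset (Fin m), J ⊆ I →
      (Measure.pi fun _ : Fin m => D) (cell A (B h) I J)
        = D A ^ I.card * D Aᶜ ^ (m - I.card)
          * (ENNReal.ofReal (r h) ^ J.card * ENNReal.ofReal (1 - r h) ^ (I.card - J.card)) := by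
    intro I J hJ
    have e : D A ^ I.card = D A ^ J.card * D A ^ (I.card - J.card) := by
      rw [← pow_add, Nat.add_sub_cancel' (Finset.card_le_card hJ)]
    rw [cell, Measure.pi_pi]
    simp only [apply_ite D]
    rw [prod_ite_mem_ite_mem hJ, hD, hdiff, mul_pow, mul_pow, e]
    ring
  unfold expKl
  rw [lintegral_finsetSum _ fun I _ => Finset.measurable_sum _ fun J _ =>
    measurable_const.indicator (hcell I J)]
  calc ∑ I : Finset (Fin m), ∫⁻ S, ∑ J ∈ I.powerset,
        (cell A (B h) I J).indicator (fun _ => klWeight I.card J.card (r h)) S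
          ∂(Measure.pi fun _ : Fin m => D)
      ≤ ∑ I : Finset (Fin m), D A ^ I.card * D Aᶜ ^ (m - I.card) := by
        refine Finset.sum_le_sum fun I _ => ?_
        rw [lintegral_finsetSum _ fun J _ => measurable_const.indicator (hcell I J)]
        calc ∑ J ∈ I.powerset, ∫⁻ S,
              (cell A (B h) I J).indicator (fun _ => klWeight I.card J.card (r h)) S
                ∂(Measure.pi fun _ : Fin m => D)
            = D A ^ I.card * D Aᶜ ^ (m - I.card) * ∑ J ∈ I.powerset,
                ENNReal.ofReal (r h) ^ J.card * ENNReal.ofReal (1 - r h) ^ (I.card - J.card)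
                  * klWeight I.card J.card (r h) := by
              rw [Finset.mul_sum]
              refine Finset.sum_congr rfl fun J hJ => ?_
              rw [lintegral_indicator_const (hcell I J), hmeas I J (Finset.mem_powerset.mp hJ)]
              ring
          _ ≤ D A ^ I.card * D Aᶜ ^ (m - I.card) * 1 := by
              gcongr
              exact sum_powerset_mul_klWeight_le_one I hr
          _ = _ := mul_one _
    _ = 1 := by
        have := Finset.sum_pow_mul_eq_add_pow (D A) (D Aᶜ) (Finset.univ : Finset (Fin m))
        rw [Finset.powerset_univ, Finset.card_univ, Fintype.card_fin] at this
        rw [this, measure_add_measure_compl hA, measure_univ, one_pow]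

end Cells

/-! ### From the moment bound to all posteriors -/

theorem exists_event_lintegral_expKl_le {Z H : Type*} [MeasurableSpace Z] [MeasurableSpace H]
    (D : Measure Z) [IsProbabilityMeasure D] {A : Set Z} (hA : MeasurableSet A) {B : H → Set Z}
    (hB : MeasurableSet {p : H × Z | p.2 ∈ B p.1}) {r : H → ℝ} (hr : Measurable r)
    (hr01 : ∀ h, r h ∈ Set.Icc (0 : ℝ) 1)
    (hD : ∀ h, D (A ∩ B h) = D A * ENNReal.ofReal (r h))
    (π : Measure H) [IsProbabilityMeasure π] {δ : ℝ} (hδ : 0 < δ) (m : ℕ) :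
    ∃ E : Set (Fin m → Z), MeasurableSet E ∧
      (Measure.pi fun _ : Fin m => D) Eᶜ ≤ ENNReal.ofReal δ ∧
      ∀ S ∈ E, ∫⁻ h, expKl A B r S h ∂π ≤ ENNReal.ofReal (1 / δ) := by
  have hm := measurable_expKl hA hB hr m
  have hm' : Measurable fun S : Fin m → Z => ∫⁻ h, expKl A B r S h ∂π :=
    hm.lintegral_prod_right'
  refine ⟨{S | ∫⁻ h, expKl A B r S h ∂π ≤ ENNReal.ofReal (1 / δ)},
    measurableSet_le hm' measurable_const, ?_, fun S hS => hS⟩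
  have hpos : 0 < 1 / δ := by positivity
  have hint : ∫⁻ S, ∫⁻ h, expKl A B r S h ∂π ∂(Measure.pi fun _ : Fin m => D) ≤ 1 := by
    rw [lintegral_lintegral_swap hm.aemeasurable]
    have hBh : ∀ h, MeasurableSet (B h) := fun h => measurable_prodMk_left hB
    calc _ ≤ ∫⁻ _, 1 ∂π := lintegral_mono fun h =>
          lintegral_expKl_le_one D hA (hBh h) (hr01 h) (hD h) m
      _ = 1 := by simp
  calc _ ≤ (Measure.pi fun _ : Fin m => D)
        {S | ENNReal.ofReal (1 / δ) ≤ ∫⁻ h, expKl A B r S h ∂π} := by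
        refine measure_mono fun S hS => ?_
        rw [Set.mem_compl_iff, Set.mem_ofPred_eq, not_le] at hS
        exact hS.le
    _ ≤ (∫⁻ S, ∫⁻ h, expKl A B r S h ∂π ∂(Measure.pi fun _ : Fin m => D))
        / ENNReal.ofReal (1 / δ) :=
        meas_ge_le_lintegral_div hm'.aemeasurable (ENNReal.ofReal_pos.mpr hpos).ne'
          ENNReal.ofReal_ne_top
    _ ≤ 1 / ENNReal.ofReal (1 / δ) := by gcongr
    _ = ENNReal.ofReal δ := by
        rw [one_div, ← ENNReal.ofReal_inv_of_pos hpos, one_div, inv_inv]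

theorem abs_klAffine_le {α β q p : ℝ} (hα : 0 < α) (hβ : 0 < β) (hq : q ∈ Set.Icc (0 : ℝ) 1)
    (hp : p ∈ Set.Icc (0 : ℝ) 1) :
    |klAffine α β q p| ≤ |Real.log α| + |Real.log β| + 1 + α + β := by
  obtain ⟨hq0, hq1⟩ := hq
  obtain ⟨hp0, hp1⟩ := hp
  have h1 : |q * Real.log α| ≤ |Real.log α| := by
    rw [abs_mul, abs_of_nonneg hq0]
    exact mul_le_of_le_one_left (abs_nonneg _) hq1
  have h2 : |(1 - q) * Real.log β| ≤ |Real.log β| := by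
    rw [abs_mul, abs_of_nonneg (by linarith)]
    exact mul_le_of_le_one_left (abs_nonneg _) (by linarith)
  have h3 : p * α ≤ α := mul_le_of_le_one_left hα.le hp1
  have h4 : (1 - p) * β ≤ β := mul_le_of_le_one_left hβ.le (by linarith)
  have h5 : 0 ≤ p * α := by positivity
  have h6 : 0 ≤ (1 - p) * β := mul_nonneg (by linarith) hβ.le
  rw [klAffine]
  rw [abs_le] at h1 h2 ⊢
  constructor <;> linarith

theorem integrable_of_mem_Icc {H : Type*} [MeasurableSpace H] {ρ : Measure H}
    [IsProbabilityMeasure ρ] {g : H → ℝ} (hg : Measurable g)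
    (hg01 : ∀ h, g h ∈ Set.Icc (0 : ℝ) 1) : Integrable g ρ :=
  Integrable.of_bound hg.aestronglyMeasurable 1 <| .of_forall fun h => by
    rw [Real.norm_eq_abs, abs_of_nonneg (hg01 h).1]
    exact (hg01 h).2

theorem integral_mem_Icc {H : Type*} [MeasurableSpace H] {ρ : Measure H}
    [IsProbabilityMeasure ρ] {g : H → ℝ} (hg : Measurable g)
    (hg01 : ∀ h, g h ∈ Set.Icc (0 : ℝ) 1) : ∫ h, g h ∂ρ ∈ Set.Icc (0 : ℝ) 1 := by
  refine ⟨integral_nonneg fun h => (hg01 h).1, ?_⟩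
  calc ∫ h, g h ∂ρ ≤ ∫ _, (1 : ℝ) ∂ρ :=
        integral_mono (integrable_of_mem_Icc hg hg01) (integrable_const _) fun h => (hg01 h).2
    _ = 1 := by simp

/-- The deterministic part of the PAC-Bayes bound: a bound on the prior average of the exponential
moment controls all posteriors. -/
theorem binKL_integral_le_complexity {Z H : Type*} [MeasurableSpace H]
    {f : H → Z → ℝ} (hf01 : ∀ h z, f h z = 0 ∨ f h z = 1)
    {A : Set Z} {r : H → ℝ} (hr : Measurable r) (hr01 : ∀ h, r h ∈ Set.Icc (0 : ℝ) 1)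
    {π : Measure H} [IsProbabilityMeasure π] {δ : ℝ} (hδ : 0 < δ ∧ δ ≤ 1) {m : ℕ}
    {S : Fin m → Z} (hfS : ∀ i, Measurable fun h => f h (S i))
    (hS : ∫⁻ h, expKl A (fun h => {z | f h z = 1}) r S h ∂π ≤ ENNReal.ofReal (1 / δ))
    {I : Finset (Fin m)} (hI : ∀ i, i ∈ I ↔ S i ∈ A)
    {ρ : Measure H} [IsProbabilityMeasure ρ] :
    binKL (∫ h, (∑ i ∈ I, f h (S i)) / (I.card : ℝ) ∂ρ) (∫ h, r h ∂ρ)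
      ≤ complexity ρ π δ I.card := by
  classical
  rw [complexity]
  split_ifs with hI0
  · exact le_top
  by_cases hkl : InformationTheory.klDiv ρ π = ⊤
  -- An infinite divergence makes the bound trivial; otherwise `ρ` is absolutely continuous with
  -- respect to `π` and change of measure applies.
  · rw [hkl, top_add, ENNReal.top_div_of_ne_top (by simp)]
    exact le_top
  set n := I.card with hn
  have hnpos : 0 < n := Nat.pos_of_ne_zero hI0
  have hn' : (0 : ℝ) < n := by exact_mod_cast hnpos
  have hsqrt : (1 : ℝ) ≤ √n := Real.one_le_sqrt.mpr (by exact_mod_cast hnpos)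
  set J : H → Finset (Fin m) := fun h => I.filter fun i => f h (S i) = 1 with hJ
  set q : H → ℝ := fun h => (∑ i ∈ I, f h (S i)) / (n : ℝ) with hq
  have hqJ : ∀ h, q h = (J h).card / n := by
    intro h
    have : ∑ i ∈ I, f h (S i) = (J h).card := by
      rw [hJ, Finset.card_filter, Nat.cast_sum]
      refine Finset.sum_congr rfl fun i _ => ?_
      rcases hf01 h (S i) with h0 | h0 <;> simp [h0]
    rw [hq]
    simp only [this]
  have hJle : ∀ h, (J h).card ≤ n := fun h => Finset.card_filter_le _ _
  have hqmeas : Measurable q := (Finset.measurable_sum _ fun i _ => hfS i).div_const _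
  have hq01 : ∀ h, q h ∈ Set.Icc (0 : ℝ) 1 := fun h => by
    rw [hqJ]
    exact ⟨by positivity, div_le_one_of_le₀ (by exact_mod_cast hJle h) hn'.le⟩
  have hqint : Integrable q ρ := integrable_of_mem_Icc hqmeas hq01
  have hrint : Integrable r ρ := integrable_of_mem_Icc hr hr01
  have hlog : 0 ≤ Real.log (2 * √n / δ) := by
    refine Real.log_nonneg ?_
    rw [le_div_iff₀ hδ.1]
    linarith [hδ.2]
  have hC : (InformationTheory.klDiv ρ π + ENNReal.ofReal (Real.log (2 * √n / δ))) / n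
      = ENNReal.ofReal
        (((InformationTheory.klDiv ρ π).toReal + Real.log (2 * √n / δ)) / n) := by
    rw [ENNReal.ofReal_div_of_pos hn', ENNReal.ofReal_add ENNReal.toReal_nonneg hlog,
      ENNReal.ofReal_toReal hkl, ENNReal.ofReal_natCast]
  rw [hC]
  refine binKL_le_ofReal (integral_mem_Icc hqmeas hq01) (integral_mem_Icc hr hr01) fun α hα β hβ => ?_
  have hΨ : Measurable fun h => klAffine α β (q h) (r h) := by
    unfold klAffine
    fun_prop
  -- Affinity in `(q, p)` makes this an equality; it replaces Jensen's inequality for kl.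
  have hΨint : ∫ h, n * klAffine α β (q h) (r h) ∂ρ
      = n * klAffine α β (∫ h, q h ∂ρ) (∫ h, r h ∂ρ) := by
    have e : ∀ x y, klAffine α β x y = x * (Real.log α - Real.log β) + y * (β - α)
        + (Real.log β + 1 - β) := fun x y => by rw [klAffine]; ring
    simp only [e]
    have hadd : Integrable
        (fun h => q h * (Real.log α - Real.log β) + r h * (β - α)) ρ :=
      (hqint.mul_const _).add (hrint.mul_const _)
    rw [integral_const_mul, integral_add hadd (integrable_const _),
      integral_add (hqint.mul_const _) (hrint.mul_const _), integral_mul_const,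
      integral_mul_const]
    simp
  have hbound : ∀ h, |n * klAffine α β (q h) (r h)|
      ≤ n * (|Real.log α| + |Real.log β| + 1 + α + β) := fun h => by
    rw [abs_mul, abs_of_pos hn']
    gcongr
    exact abs_klAffine_le hα hβ (hq01 h) (hr01 h)
  have hexpmeas : Measurable fun h => Real.exp (n * klAffine α β (q h) (r h)) := by fun_prop
  have hexpint : Integrable (fun h => Real.exp (n * klAffine α β (q h) (r h))) π :=
    Integrable.of_bound hexpmeas.aestronglyMeasurable
      (Real.exp (n * (|Real.log α| + |Real.log β| + 1 + α + β))) (.of_forall fun h => by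
        rw [Real.norm_eq_abs, abs_of_pos (Real.exp_pos _)]
        exact Real.exp_le_exp.mpr ((le_abs_self _).trans (hbound h)))
  have hDV := integral_le_klDiv_add_log_integral_exp (π := π) hkl
    (φ := fun h => n * klAffine α β (q h) (r h))
    (Integrable.of_bound (hΨ.const_mul _).aestronglyMeasurable _ (.of_forall hbound)) hexpint
  have hmoment : ∫ h, Real.exp (n * klAffine α β (q h) (r h)) / (2 * √n) ∂π ≤ 1 / δ := by
    rw [integral_eq_lintegral_of_nonneg_ae (.of_forall fun h => by positivity)
      (hexpmeas.div_const _).aestronglyMeasurable]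
    refine ENNReal.toReal_le_of_le_ofReal (one_div_pos.mpr hδ.1).le ((lintegral_mono ?_).trans hS)
    intro h
    simp only [hqJ]
    refine (ofReal_exp_klAffine_le_klWeight hnpos (hJle h) hα hβ (hr01 h)).trans ?_
    exact klWeight_le_expKl hI fun i => by simp [hJ]
  rw [integral_div, div_le_iff₀ (by positivity)] at hmoment
  have hpos : 0 < ∫ h, Real.exp (n * klAffine α β (q h) (r h)) ∂π :=
    integral_exp_pos hexpint
  have hlogle := Real.log_le_log hpos hmoment
  have e : 1 / δ * (2 * √(n : ℝ)) = 2 * √n / δ := by ring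
  rw [e] at hlogle
  rw [hΨint] at hDV
  rw [le_div_iff₀ hn', mul_comm]
  linarith

theorem klUpper_ge {q r : ℝ} {ε : ENNReal} (hr : r ∈ Set.Icc (0 : ℝ) 1) (h : binKL q r ≤ ε) :
    r ≤ klUpper q ε :=
  le_csSup ⟨1, fun _ hx => hx.1.2⟩ ⟨hr, h⟩

theorem klLower_le {q r : ℝ} {ε : ENNReal} (hr : r ∈ Set.Icc (0 : ℝ) 1) (h : binKL q r ≤ ε) :
    klLower q ε ≤ r :=
  csInf_le ⟨0, fun _ hx => hx.1.1⟩ ⟨hr, h⟩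

/-! ### Application to the risks -/

section Risks

variable {X Y' H : Type*} [MeasurableSpace X] [MeasurableSpace H]

theorem measurable_loss {ℓ : Y' → Label → ℝ} {pred : H → X → Y'}
    (hmeas : Measurable fun p : H × X × Label => ℓ (pred p.1 p.2.1) p.2.2) :
    Measurable fun p : H × Example X => ℓ (pred p.1 p.2.1) p.2.2.2 :=
  hmeas.comp (f := fun p : H × Example X => (p.1, p.2.1, p.2.2.2)) (by fun_prop)

theorem trueRisk_inputLabel_eq {ℓ : Y' → Label → ℝ} (hℓ : ∀ y' y, ℓ y' y = 0 ∨ ℓ y' y = 1)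
    {pred : H → X → Y'}
    (hmeas : Measurable fun p : H × X × Label => ℓ (pred p.1 p.2.1) p.2.2)
    (P : Measure (Example X)) (h : H) :
    trueRisk ℓ pred (inputLabel P) h = P.real {z | ℓ (pred h z.1) z.2.2 = 1} := by
  have hz : Measurable fun z : X × Label => ℓ (pred h z.1) z.2 := hmeas.comp measurable_prodMk_left
  have hz' : Measurable fun z : Example X => ℓ (pred h z.1) z.2.2 :=
    (measurable_loss hmeas).comp measurable_prodMk_left
  rw [trueRisk, inputLabel, integral_map (by fun_prop) hz.aestronglyMeasurable]
  have e : (fun z : Example X => ℓ (pred h z.1) z.2.2)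
      = {z : Example X | ℓ (pred h z.1) z.2.2 = 1}.indicator 1 := by
    ext z
    rcases hℓ (pred h z.1) z.2.2 with h0 | h0 <;> simp [Set.indicator, h0]
  simp only [e]
  exact integral_indicator_one (hz' (measurableSet_singleton 1))

/-- The PAC-Bayes-kl bound for the examples of the sample that lie in a measurable set `A`,
compared with the Gibbs risk under the conditional distribution given `A`. -/
theorem exists_event_gibbsRisk_mem (D : Measure (Example X)) [IsProbabilityMeasure D]
    (ℓ : Y' → Label → ℝ) (hℓ : ∀ y' y, ℓ y' y = 0 ∨ ℓ y' y = 1) (pred : H → X → Y')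
    (hmeas : Measurable fun p : H × X × Label => ℓ (pred p.1 p.2.1) p.2.2)
    (π : Measure H) [IsProbabilityMeasure π] {δ : ℝ} (hδ : 0 < δ ∧ δ ≤ 1) (m : ℕ)
    {A : Set (Example X)} (hA : MeasurableSet A) :
    ∃ E : Set (Sample X m), MeasurableSet E ∧
      (Measure.pi fun _ : Fin m => D).real Eᶜ ≤ δ ∧
      ∀ S ∈ E, ∀ ρ : Measure H, IsProbabilityMeasure ρ → ∀ I : Finset (Fin m),
        (∀ i, i ∈ I ↔ S i ∈ A) →
        riskLower ℓ pred S I ρ π δ ≤ gibbsRisk ℓ pred (inputLabel (cond D A)) ρ ∧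
          gibbsRisk ℓ pred (inputLabel (cond D A)) ρ ≤ riskUpper ℓ pred S I ρ π δ := by
  set f : H → Example X → ℝ := fun h z => ℓ (pred h z.1) z.2.2 with hf
  set B : H → Set (Example X) := fun h => {z | f h z = 1} with hBdef
  set r : H → ℝ := trueRisk ℓ pred (inputLabel (cond D A)) with hrdef
  have hfm := measurable_loss hmeas
  have hB : MeasurableSet {p : H × Example X | p.2 ∈ B p.1} := hfm (measurableSet_singleton 1)
  have hreq : ∀ h, r h = (cond D A).real (B h) :=
    trueRisk_inputLabel_eq hℓ hmeas _
  have hr : Measurable r := by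
    rw [funext hreq]
    exact (measurable_measure_prodMk_left hB).ennreal_toReal
  have hr01 : ∀ h, r h ∈ Set.Icc (0 : ℝ) 1 := fun h => by
    rw [hreq]
    exact ⟨measureReal_nonneg, measureReal_le_one⟩
  -- If `D A = 0`, the conditional measure and `r` vanish and both sides are 0, so null groups need
  -- no separate case.
  have hD : ∀ h, D (A ∩ B h) = D A * ENNReal.ofReal (r h) := fun h => by
    rw [hreq, ofReal_measureReal, mul_comm, cond_mul_eq_inter hA]
  obtain ⟨E, hE, hEδ, hES⟩ := exists_event_lintegral_expKl_le D hA hB hr hr01 hD π hδ.1 m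
  refine ⟨E, hE, ENNReal.toReal_le_of_le_ofReal hδ.1.le hEδ, fun S hS ρ hρ I hI => ?_⟩
  have hkl := binKL_integral_le_complexity (f := f) (fun h z => hℓ _ _) hr hr01 hδ
    (fun i => hfm.comp measurable_prodMk_right) (hES S hS) hI (ρ := ρ)
  have hmem : ∫ h, r h ∂ρ ∈ Set.Icc (0 : ℝ) 1 := integral_mem_Icc hr hr01
  exact ⟨klLower_le hmem hkl, klUpper_ge hmem hkl⟩

end Risks

end PACBayesFair

theorem mainTheorem6 {X Y' H : Type*} [MeasurableSpace X] [MeasurableSpace H]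
    (D : Measure (PACBayesFair.Example X)) [IsProbabilityMeasure D]
    (ℓ : Y' → PACBayesFair.Label → ℝ) (hℓ : ∀ y' y, ℓ y' y = 0 ∨ ℓ y' y = 1)
    (pred : H → X → Y')
    (hmeas : Measurable fun p : H × X × PACBayesFair.Label => ℓ (pred p.1 p.2.1) p.2.2)
    (π : Measure H) [IsProbabilityMeasure π]
    (δ : ℝ) (hδ : 0 < δ ∧ δ ≤ 1) (lam : ℝ) (hlam : 0 ≤ lam ∧ lam ≤ 1) (m : ℕ) :
    ∃ E : Set (PACBayesFair.Sample X m), MeasurableSet E ∧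
      1 - δ ≤ (Measure.pi fun _ : Fin m => D).real E ∧
      ∀ S ∈ E, ∀ ρ : Measure H, IsProbabilityMeasure ρ →
        (1 - lam) * PACBayesFair.gibbsRisk ℓ pred (PACBayesFair.inputLabel D) ρ
            + lam * PACBayesFair.fairRisk ℓ pred D ρ
          ≤ PACBayesFair.trainingObjective ℓ pred S ρ π δ lam := by
  obtain ⟨hδ0, hδ1⟩ := hδ
  have hgroup : ∀ g : PACBayesFair.SensGroup,
      MeasurableSet {z : PACBayesFair.Example X | z.2.1 = g} := fun g =>
    (measurable_fst.comp measurable_snd) (MeasurableSpace.measurableSet_top (s := {g}))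
  obtain ⟨E₀, hE₀, hP₀, h₀⟩ := PACBayesFair.exists_event_gibbsRisk_mem D ℓ hℓ pred hmeas π
    (δ := δ / 2) ⟨by linarith, by linarith⟩ m MeasurableSet.univ
  obtain ⟨E₁, hE₁, hP₁, h₁⟩ := PACBayesFair.exists_event_gibbsRisk_mem D ℓ hℓ pred hmeas π
    (δ := δ / 8) ⟨by linarith, by linarith⟩ m (hgroup .a)
  obtain ⟨E₂, hE₂, hP₂, h₂⟩ := PACBayesFair.exists_event_gibbsRisk_mem D ℓ hℓ pred hmeas π
    (δ := δ / 8) ⟨by linarith, by linarith⟩ m (hgroup .b)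
  have hE : MeasurableSet (E₀ ∩ (E₁ ∩ E₂)) := hE₀.inter (hE₁.inter hE₂)
  refine ⟨E₀ ∩ (E₁ ∩ E₂), hE, ?_, ?_⟩
  · have hc := probReal_compl_eq_one_sub (μ := Measure.pi fun _ : Fin m => D) hE
    -- The failure probabilities total `3δ/4`, within the allowed `δ`.
    have hle : (Measure.pi fun _ : Fin m => D).real (E₀ ∩ (E₁ ∩ E₂))ᶜ ≤ δ / 2 + (δ / 8 + δ / 8) := by
      rw [Set.compl_inter, Set.compl_inter]
      exact (measureReal_union_le _ _).trans
        (add_le_add hP₀ ((measureReal_union_le _ _).trans (add_le_add hP₁ hP₂)))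
    linarith
  · rintro S ⟨hS₀, hS₁, hS₂⟩ ρ hρ
    have k₀ := (h₀ S hS₀ ρ hρ Finset.univ (by simp)).2
    rw [cond_univ] at k₀
    obtain ⟨l₁, u₁⟩ := h₁ S hS₁ ρ hρ (PACBayesFair.groupIdx S .a)
      (by simp [PACBayesFair.groupIdx])
    obtain ⟨l₂, u₂⟩ := h₂ S hS₂ ρ hρ (PACBayesFair.groupIdx S .b)
      (by simp [PACBayesFair.groupIdx])
    rw [PACBayesFair.trainingObjective, PACBayesFair.fairRisk, PACBayesFair.groupDist,
      PACBayesFair.groupDist]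
    refine add_le_add (mul_le_mul_of_nonneg_left k₀ (by linarith [hlam.2]))
      (mul_le_mul_of_nonneg_left ?_ hlam.1)
    refine abs_le'.mpr ⟨le_max_of_le_left ?_, le_max_of_le_right ?_⟩ <;> linarith
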